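/- **Trust-aware bandits.** A trust-aware $K$-armed bandit consists of a law of reward vectors $(R(1),\dots,R(K))\in[0,1]^K$ with means $r(k)$ and $r^\star=\max_k r(k)$, a trust set $\mathcal T\subset[K]$ containing an arm $k$ with $r(k)=r^\star$, and an own policy $(\pi^{\mathsf{own}}_h)_{h\ge1}$ of probability distributions on $[K]$. Put $\alpha_1=\beta_1=1$. In round $h\ge 1$ the policy-maker recommends an arm $a^{\mathsf{pm}}_h$ on the basis of the past observations. Conditionally on the past, and independently of $a^{\mathsf{pm}}_h$ and of each other, one draws $\chi_h\sim\mathrm{Bern}(t_h)$ with trust level $t_h=\alpha_h/(\alpha_h+\beta_h)$, an arm $a^{\mathsf{own}}_h\sim\pi^{\mathsf{own}}_h$, and a fresh reward vector $R_h$ from the reward law. The pulled arm is $a^{\mathsf{ac}}_h=a^{\mathsf{pm}}_h$ if $\chi_h=1$ and $a^{\mathsf{ac}}_h=a^{\mathsf{own}}_h$ if $\chi_h=0$, and the policy-maker observes $(a^{\mathsf{ac}}_h,R_h(a^{\mathsf{ac}}_h),\chi_h)$. Then $\alpha_{h+1}=\alpha_h+\mathbf 1\{a^{\mathsf{pm}}_h\in\mathcal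 T\}$ and $\beta_{h+1}=\beta_h+\mathbf 1\{a^{\mathsf{pm}}_h\notin\mathcal T\}$. The expected regret over $H$ rounds is $\mathbb E[\mathsf{reg}_H]=\mathbb E\big[\sum_{h=1}^H(r^\star-r(a^{\mathsf{ac}}_h))\big]$. **UCB.** The (trust-blind) UCB algorithm with horizon $H$ recommends in each round $h$ an arm maximizing $\mathsf{UCB}_h(a)$, with ties broken uniformly at random, where $\mathsf{UCB}_1(a)=1$ and, for $h\ge2$, with $N_h(a)=1\vee\sum_{i<h}\mathbf 1\{a^{\mathsf{ac}}_i=a\}$, $$\mathsf{UCB}_h(a)=\frac1{N_h(a)}\sum_{i<h}R_i(a)\,\mathbf 1\{a^{\mathsf{ac}}_i=a\}+2\sqrt{\frac{\log H}{N_h(a)}}.$$ **Theorem.** There are constants $c,C>0$ such that for every horizon $H\ge2$ there is a trust-aware bandit with $K=260$ arms, trust set $\mathcal T=\{K\}$, own policy $\pi^{\mathsf{own}}_h=\mathrm{Unif}(\{K-1,K\})$ for all $h$, and expected rewards $r(K)=\frac1{3\sqrt{\log H+1}}$ and $r(k)=\frac1{6\sqrt{\log H+1}}$ for $k<K$, on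 which the UCB algorithm with horizon $H$ satisfies $$\mathbb E[\mathsf{reg}_H]\ \ge\ \frac{cH}{\sqrt{\log H}}\qquad\text{and}\qquad \mathbb P\Big(\sum_{h=1}^H t_h> C\log^2 H\Big)\le 4H^{-1/3}.$$ -/

import Mathlib

open MeasureTheory ProbabilityTheory

noncomputable section

namespace TrustMAB

/-- The full outcome of one round: the recommended arm `a^pm`, the compliance indicator `χ`
(`true` if the recommendation is followed), the arm `a^own` drawn from the implementer's own policy,
and the vector `(R(1), …, R(K))` of the rewards of all the arms in this round. -/
abbrev Round (K : ℕ) : Type := Fin K × Bool × Fin K × (Fin K → ℝ)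

/-- What the policy-maker sees of a round: the arm `a^ac` that was actually pulled, its reward
`R(a^ac)`, and the compliance indicator `χ`. -/
abbrev Obs (K : ℕ) : Type := Fin K × ℝ × Bool

namespace Round

variable {K : ℕ}

/-- The recommended arm. -/
def pm (x : Round K) : Fin K := x.1

/-- The compliance indicator. -/
def chi (x : Round K) : Bool := x.2.1

/-- The arm drawn from the implementer's own policy. -/
def own (x : Round K) : Fin K := x.2.2.1

/-- The rewards of all the arms. -/
def rewards (x : Round K) : Fin K → ℝ := x.2.2.2

/-- The arm that is actually pulled: the recommended one if `χ = 1`, the own one if `χ = 0`. -/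
def ac (x : Round K) : Fin K := if x.chi = true then x.pm else x.own

/-- The observation that the policy-maker makes in this round. -/
def obs (x : Round K) : Obs K := (x.ac, x.rewards x.ac, x.chi)

@[fun_prop]
lemma measurable_pm : Measurable (pm : Round K → Fin K) := measurable_fst

@[fun_prop]
lemma measurable_chi : Measurable (chi : Round K → Bool) := by unfold chi; fun_prop

@[fun_prop]
lemma measurable_own : Measurable (own : Round K → Fin K) := by unfold own; fun_prop

@[fun_prop]
lemma measurable_rewards : Measurable (rewards : Round K → Fin K → ℝ) := by
  unfold rewards; fun_prop

@[fun_prop]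
lemma measurable_ac : Measurable (ac : Round K → Fin K) := by
  unfold ac
  exact Measurable.ite (measurable_chi (measurableSet_singleton true)) measurable_pm measurable_own

@[fun_prop]
lemma measurable_obs : Measurable (obs : Round K → Obs K) := by
  have h : Measurable fun x : Round K => x.rewards x.ac := by
    have e : (fun x : Round K => x.rewards x.ac)
        = fun x => ∑ a, if x.ac = a then x.rewards a else 0 := by
      funext x; simp
    rw [e]
    refine Finset.measurable_sum _ fun a _ => ?_
    exact Measurable.ite (measurable_ac (measurableSet_singleton a))
      ((measurable_pi_apply a).comp measurable_rewards) measurable_const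
  unfold obs
  fun_prop

end Round

/-- `α = 1 + #{i < j : a_i ∈ T}`, where `a_i` are the recommended arms: the parameter `α` after the
first `j` rounds, started at `1` and increased by one with each recommendation in `T`. -/
def alpha {K n : ℕ} (T : Finset (Fin K)) (a : Fin n → Fin K) (j : ℕ) : ℕ :=
  1 + (Finset.univ.filter fun i : Fin n => (i : ℕ) < j ∧ a i ∈ T).card

/-- `β = 1 + #{i < j : a_i ∉ T}`: the parameter `β` after the first `j` rounds, started at `1` and
increased by one with each recommendation outside `T`. -/
def beta {K n : ℕ} (T : Finset (Fin K)) (a : Fin n → Fin K) (j : ℕ) : ℕ :=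
  1 + (Finset.univ.filter fun i : Fin n => (i : ℕ) < j ∧ a i ∉ T).card

/-- The trust level `α / (α + β)` after the first `j` rounds, which is the one in force in round
`j + 1`. It is a number in the unit interval. -/
def trust {K n : ℕ} (T : Finset (Fin K)) (a : Fin n → Fin K) (j : ℕ) : unitInterval :=
  ⟨(alpha T a j : ℝ) / ((alpha T a j : ℝ) + (beta T a j : ℝ)),
    by positivity, div_le_one_of_le₀ (by simp) (by positivity)⟩

/-- A policy of the policy-maker: for each `n`, the conditional law of the arm recommended in round
`n + 1` given the observations of the first `n` rounds. -/
structure Policy (K : ℕ) where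
  kernel : (n : ℕ) → Kernel (Fin n → Obs K) (Fin K)
  markov : ∀ n, IsMarkovKernel (kernel n)

attribute [instance] Policy.markov

/-- A trust-aware `K`-armed bandit: the joint law of the rewards of the `K` arms in one round
(supported in `[0,1]^K`), the implementer's trust set, and her own policy (`ownPolicy n` is the law
of her own arm in round `n + 1`). The trust set contains an arm of maximal expected reward. -/
structure TrustBandit (K : ℕ) where
  rewardLaw : ProbabilityMeasure (Fin K → ℝ)
  reward_mem : ∀ᵐ x ∂(rewardLaw : Measure (Fin K → ℝ)), ∀ k, x k ∈ Set.Icc (0 : ℝ) 1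
  trustSet : Finset (Fin K)
  ownPolicy : ℕ → ProbabilityMeasure (Fin K)
  exists_optimal_mem : ∃ k ∈ trustSet, ∀ j,
    ∫ x, x j ∂(rewardLaw : Measure (Fin K → ℝ)) ≤ ∫ x, x k ∂(rewardLaw : Measure (Fin K → ℝ))

namespace TrustBandit

variable {K : ℕ} (M : TrustBandit K) (π : Policy K)

/-- The expected reward `r(k)` of arm `k`. -/
def mean (k : Fin K) : ℝ := ∫ x, x k ∂(M.rewardLaw : Measure (Fin K → ℝ))

/-- The maximal expected reward `r⋆`. -/
def optMean : ℝ := ⨆ k, M.mean k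

/-- The law of `χ` given the history: Bernoulli with the current trust level. -/
def chiKernel (n : ℕ) : Kernel (Fin n → Round K) Bool where
  toFun w := bernoulliMeasure true false (trust M.trustSet (fun i => (w i).pm) n)
  measurable' := by
    have h1 : Measurable fun a : Fin n → Fin K =>
        bernoulliMeasure true false (trust M.trustSet a n) := measurable_of_countable _
    exact h1.comp (by fun_prop : Measurable fun (w : Fin n → Round K) i => (w i).pm)

instance (n : ℕ) : IsMarkovKernel (M.chiKernel n) :=
  ⟨fun w => inferInstanceAs (IsProbabilityMeasure
    (bernoulliMeasure true false (trust M.trustSet (fun i => (w i).pm) n)))⟩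

/-- The law of round `n + 1` given the first `n` rounds: given the past, the recommended arm (drawn
by the policy from the past observations), the compliance indicator (Bernoulli with the current
trust level), the own arm and the reward vector are independent. -/
def roundKernel (n : ℕ) : Kernel (Fin n → Round K) (Round K) :=
  ((π.kernel n).comap (fun w i => (w i).obs) (by fun_prop)) ×ₖ
    (M.chiKernel n ×ₖ
      (Kernel.const _ (M.ownPolicy n : Measure (Fin K)) ×ₖ
        Kernel.const _ (M.rewardLaw : Measure (Fin K → ℝ))))

instance (n : ℕ) : IsMarkovKernel (M.roundKernel π n) := by
  unfold roundKernel; infer_instance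

/-- The joint law of the first `n` rounds under the policy `π`. -/
def law : (n : ℕ) → Measure (Fin n → Round K)
  | 0 => Measure.dirac Fin.elim0
  | n + 1 => (law n ⊗ₘ M.roundKernel π n).map
      fun p => (Fin.snoc p.1 p.2 : Fin (n + 1) → Round K)

lemma measurable_snoc (n : ℕ) : Measurable
    fun p : (Fin n → Round K) × Round K => (Fin.snoc p.1 p.2 : Fin (n + 1) → Round K) := by
  refine measurable_pi_lambda _ fun i => ?_
  refine Fin.lastCases ?_ (fun j => ?_) i
  · simpa using measurable_snd
  · simp only [Fin.snoc_castSucc]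
    fun_prop

instance isProbabilityMeasure_law (n : ℕ) : IsProbabilityMeasure (M.law π n) := by
  induction n with
  | zero => unfold law; infer_instance
  | succ n ih =>
    unfold law
    exact Measure.isProbabilityMeasure_map (measurable_snoc n).aemeasurable

/-- The expected regret `E[∑_{h=1}^H (r⋆ - r(a_h^ac))]` of the policy `π` over `H` rounds. -/
def expectedRegret (H : ℕ) : ℝ :=
  ∫ w, ∑ i : Fin H, (M.optMean - M.mean (w i).ac) ∂(M.law π H)

/-- The sum `t_1 + … + t_H` of the trust levels along the first `H` rounds. -/
def trustSum {H : ℕ} (w : Fin H → Round K) : ℝ :=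
  ∑ j ∈ Finset.range H, (trust M.trustSet (fun i => (w i).pm) j : ℝ)

end TrustBandit

/-- `1 ∨ ∑_i 1{a_i^ac = a}`: the number of times that arm `a` was pulled, or one if it never was. -/
def pullCount {K n : ℕ} (o : Fin n → Obs K) (a : Fin K) : ℕ :=
  max 1 (Finset.univ.filter fun i => (o i).1 = a).card

/-- The index that the (trust-blind) UCB algorithm with horizon `H` gives arm `a` after the
observations `o`: it is `1` before the first round, and afterwards the empirical mean reward of the
arm plus the bonus `2 √(log H / N)`. -/
def ucbIndex {K n : ℕ} (H : ℕ) (o : Fin n → Obs K) (a : Fin K) : ℝ :=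
  if n = 0 then 1
  else (∑ i, if (o i).1 = a then (o i).2.1 else 0) / pullCount o a
    + 2 * √(Real.log H / pullCount o a)

/-- The arms of maximal index. -/
def ucbArgmax {K n : ℕ} (H : ℕ) (o : Fin n → Obs K) : Set (Fin K) :=
  {a | ∀ b, ucbIndex H o b ≤ ucbIndex H o a}

lemma ucbArgmax_nonempty {K n : ℕ} [NeZero K] (H : ℕ) (o : Fin n → Obs K) :
    (ucbArgmax H o).Nonempty :=
  Finite.exists_max (ucbIndex H o)

@[fun_prop]
lemma measurable_ucbIndex {K n : ℕ} (H : ℕ) (a : Fin K) :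
    Measurable fun o : Fin n → Obs K => ucbIndex H o a := by
  have hs : ∀ i : Fin n, MeasurableSet {o : Fin n → Obs K | (o i).1 = a} := fun i =>
    (by fun_prop : Measurable fun o : Fin n → Obs K => (o i).1) (measurableSet_singleton a)
  have hN : Measurable fun o : Fin n → Obs K => (pullCount o a : ℝ) := by
    have h1 : Measurable fun b : Fin n → Fin K =>
        ((max 1 (Finset.univ.filter fun i => b i = a).card : ℕ) : ℝ) := measurable_of_countable _
    exact h1.comp (by fun_prop : Measurable fun (o : Fin n → Obs K) i => (o i).1)
  unfold ucbIndex
  split_ifs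
  · exact measurable_const
  · refine Measurable.add (Measurable.div (Finset.measurable_sum _ fun i _ => ?_) hN) ?_
    · exact Measurable.ite (hs i) (by fun_prop) measurable_const
    · exact ((measurable_const.div hN).sqrt).const_mul 2

/-- The (trust-blind) UCB algorithm with horizon `H`: in each round it recommends an arm of maximal
index, with ties broken uniformly at random. -/
def ucbPolicy (K : ℕ) [NeZero K] (H : ℕ) : Policy K where
  kernel n :=
    { toFun := fun o => uniformOn (ucbArgmax H o)
      measurable' := by
        have h1 : Measurable fun s : Set (Fin K) => uniformOn s := measurable_of_countable _
        refine h1.comp (measurable_set_iff.2 fun a => ?_)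
        refine measurableSet_setOfPred.1 ?_
        have e : {o : Fin n → Obs K | a ∈ ucbArgmax H o}
            = ⋂ b, {o | ucbIndex H o b ≤ ucbIndex H o a} := by
          ext o; simp [ucbArgmax]
        rw [e]
        exact MeasurableSet.iInter fun b =>
          measurableSet_le (measurable_ucbIndex H b) (measurable_ucbIndex H a) }
  markov n := ⟨fun o =>
    isProbabilityMeasure_uniformOn (Set.toFinite _) (ucbArgmax_nonempty H o)⟩

end TrustMAB

end

/-!
The hard instance has deterministic rewards. Write `y` for the last arm, `x` for the other arm of
the own policy, `L = log H`, `U` for the number of pulls of `y` and `V` for the number of pulls of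
the `258` arms that the implementer never chooses on her own.

UCB can recommend `y` only if every other arm has been pulled at least about a quarter as often as
`y`, or `9 L (L + 1)` times (`card_mul_min_le_of_mem_ucbArgmax`): before that, the exploration
bonuses hide the gap between the means. Summing over the `258` arms, this needs
`4 V ≥ 258 (min U (36 L (L + 1)) - 4)`. But these arms are pulled only when the implementer
complies, while `y` also gets half of the rounds in which she does not. Let `T` be the sum of the
trust levels over the rounds with a recommendation other than `y`. For suitable constants,
`exp (l V - u U + a n - b T)` is a supermartingale (`lintegral_exp_exponent_snoc_le`), so that `V` is
rarely much larger than `T`, and `U` is rarely small. Recommendations of `y` raise the trust level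
but do not count in `T`, which yields `T ≤ (n + 2) / 2` (`outsideTrust_le_half`); moreover
`T ≤ α log (n + 1)`, where `α - 1` is the number of recommendations of `y`.

Consequently, a first recommendation of `y` after round `m = ⌈30 L⌉` has probability at most
`2 exp (14 - 3 L)` in each round: either `V` exceeds `64.5 U - 258`, which the first bound on `T`
makes exponentially unlikely in `n ≥ 30 L`, or `V` is of order at least `2322 L ^ 2`, while
`α ≤ m + 1` keeps `T` below about `30 L ^ 2`. Outside this event `α` is at most `m + 1`, the trust
levels decay like `m / j`, and their sum is of order `L ^ 2`. The distrust is then at least `1 / 2`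
in most rounds, so the implementer pulls `x` instead of `y` linearly often, at a cost of
`1 / (6 √(L + 1))` each time. Horizons with `L < 20` are absorbed in the constants.
-/

open MeasureTheory ProbabilityTheory

noncomputable section

namespace TrustMAB

/-! ### The law of the interaction -/

namespace TrustBandit

variable {K : ℕ} (M : TrustBandit K) (π : Policy K)

lemma lintegral_law_succ (n : ℕ) {f : (Fin (n + 1) → Round K) → ENNReal} (hf : Measurable f) :
    ∫⁻ w, f w ∂M.law π (n + 1)
      = ∫⁻ w, ∫⁻ x, f (Fin.snoc w x) ∂M.roundKernel π n w ∂M.law π n := by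
  rw [law, lintegral_map hf (measurable_snoc n),
    Measure.lintegral_compProd (f := fun p => f (Fin.snoc p.1 p.2))
      (hf.comp (measurable_snoc n))]

/-- The expectation of a nonnegative supermartingale is at most its initial value. -/
lemma lintegral_law_le_of_supermartingale {F : (n : ℕ) → (Fin n → Round K) → ENNReal}
    (hF : ∀ n, Measurable (F n))
    (hstep : ∀ n w, ∫⁻ x, F (n + 1) (Fin.snoc w x) ∂M.roundKernel π n w ≤ F n w) (n : ℕ) :
    ∫⁻ w, F n w ∂M.law π n ≤ F 0 Fin.elim0 := by
  induction n with
  | zero => rw [law, lintegral_dirac' _ (hF 0)]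
  | succ n ih =>
    rw [M.lintegral_law_succ π n (hF _)]
    exact (lintegral_mono (hstep n)).trans ih

/-- A property that almost every round has, whatever the past, holds almost surely in all rounds. -/
lemma ae_law_forall {p : Round K → Prop} (hp : MeasurableSet {x | p x})
    (h : ∀ n w, ∀ᵐ x ∂M.roundKernel π n w, p x) (n : ℕ) :
    ∀ᵐ w ∂M.law π n, ∀ i, p (w i) := by
  induction n with
  | zero => exact Filter.Eventually.of_forall fun w i => i.elim0
  | succ n ih =>
    have hm : MeasurableSet {w : Fin (n + 1) → Round K | ∀ i, p (w i)} := by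
      rw [Set.ofPred_forall]
      exact MeasurableSet.iInter fun i => measurable_pi_apply i hp
    rw [law, ae_map_iff (measurable_snoc n).aemeasurable hm]
    refine Measure.ae_compProd_of_ae_ae (measurable_snoc n hm) ?_
    filter_upwards [ih] with w hw
    filter_upwards [h n w] with x hx i
    refine Fin.lastCases ?_ (fun j => ?_) i
    · simpa using hx
    · simpa using hw j

/-- Integration over one round of a function that does not depend on the rewards. -/
lemma lintegral_roundKernel (n : ℕ) (w : Fin n → Round K)
    (f : Fin K → Bool → Fin K → ENNReal) :
    ∫⁻ x, f x.pm x.chi x.own ∂M.roundKernel π n w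
      = ∫⁻ a, ∫⁻ b, ∫⁻ o, f a b o ∂(M.ownPolicy n : Measure (Fin K)) ∂M.chiKernel n w
          ∂π.kernel n (fun i => (w i).obs) := by
  have hm : Measurable fun x : Fin K × Bool × Fin K => f x.1 x.2.1 x.2.2 :=
    measurable_of_countable _
  have hm' : Measurable fun x : Round K => f x.pm x.chi x.own :=
    hm.comp (by fun_prop : Measurable fun x : Round K => (x.pm, x.chi, x.own))
  rw [roundKernel, Kernel.lintegral_prod _ _ _ hm', Kernel.comap_apply]
  refine lintegral_congr fun a => ?_
  rw [Kernel.lintegral_prod (g := fun c => f (Round.pm (a, c)) (Round.chi (a, c)) (Round.own (a, c)))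
    _ _ _ (hm'.comp measurable_prodMk_left)]
  refine lintegral_congr fun b => ?_
  rw [Kernel.lintegral_prod
    (g := fun c => f (Round.pm (a, b, c)) (Round.chi (a, b, c)) (Round.own (a, b, c)))
    _ _ _ ((hm'.comp measurable_prodMk_left).comp measurable_prodMk_left)]
  simp only [Kernel.const_apply]
  refine lintegral_congr fun o => ?_
  simp [Round.pm, Round.chi, Round.own]

lemma lintegral_chiKernel (n : ℕ) (w : Fin n → Round K) (f : Bool → ENNReal) :
    ∫⁻ b, f b ∂M.chiKernel n w
      = ENNReal.ofReal (trust M.trustSet (fun i => (w i).pm) n : ℝ) * f true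
        + ENNReal.ofReal (1 - (trust M.trustSet (fun i => (w i).pm) n : ℝ)) * f false := by
  change ∫⁻ b, f b ∂bernoulliMeasure true false (trust M.trustSet (fun i => (w i).pm) n) = _
  generalize trust M.trustSet (fun i => (w i).pm) n = t
  rw [bernoulliMeasure_def, lintegral_add_measure, lintegral_smul_measure, lintegral_smul_measure,
    lintegral_dirac, lintegral_dirac]
  congr 1
  · rw [ENNReal.ofReal, Real.toNNReal_of_nonneg t.2.1]; rfl
  · rw [ENNReal.ofReal, Real.toNNReal_of_nonneg (sub_nonneg.2 t.2.2)]; rfl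

lemma ae_roundKernel_rewards {p : (Fin K → ℝ) → Prop} (hp : MeasurableSet {r | p r})
    (h : ∀ᵐ r ∂(M.rewardLaw : Measure (Fin K → ℝ)), p r) (n : ℕ) (w : Fin n → Round K) :
    ∀ᵐ x ∂M.roundKernel π n w, p x.rewards := by
  have hm : MeasurableSet {x : Round K | p x.rewards} := Round.measurable_rewards hp
  rw [roundKernel, Kernel.prod_apply]
  refine (Measure.ae_prod_iff_ae_ae hm).2 (Filter.Eventually.of_forall fun a => ?_)
  rw [Kernel.prod_apply]
  refine (Measure.ae_prod_iff_ae_ae (hm.preimage measurable_prodMk_left)).2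
    (Filter.Eventually.of_forall fun b => ?_)
  rw [Kernel.prod_apply]
  refine (Measure.ae_prod_iff_ae_ae
    ((hm.preimage measurable_prodMk_left).preimage measurable_prodMk_left)).2
    (Filter.Eventually.of_forall fun o => ?_)
  simpa [Round.rewards] using h

end TrustBandit

lemma lintegral_uniformOn_pair {α : Type*} [Fintype α] [DecidableEq α] [MeasurableSpace α]
    [MeasurableSingletonClass α] {x y : α} (hxy : x ≠ y) (f : α → ENNReal) :
    ∫⁻ a, f a ∂uniformOn {x, y} = 2⁻¹ * (f x + f y) := by
  have h : ∀ a, uniformOn ({x, y} : Set α) {a} = if a = x ∨ a = y then 2⁻¹ else 0 := by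
    intro a
    have e := uniformOn_apply_finset (s := ({x, y} : Finset α)) (t := {a})
    rw [Finset.coe_singleton, Finset.coe_pair, Finset.card_pair hxy] at e
    rw [e]
    split_ifs with ha
    · rw [Finset.inter_singleton_of_mem (by simpa using ha)]; simp
    · rw [Finset.inter_singleton_of_notMem (by simpa using ha)]; simp
  rw [lintegral_fintype]
  simp only [h]
  rw [← Finset.sum_subset (Finset.subset_univ {x, y}) (by
    intro a _ ha
    rw [if_neg (by simpa using ha), mul_zero]), Finset.sum_pair hxy]
  simp [add_mul, mul_comm]

namespace TrustBandit

variable {K : ℕ} (M : TrustBandit K) (π : Policy K)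

/-- Integration over one round of a function of the recommended and the pulled arm, when the own
policy is uniform on two arms. -/
lemma lintegral_roundKernel_pm_ac {x y : Fin K} (hxy : x ≠ y)
    (hown : ∀ n, (M.ownPolicy n : Measure (Fin K)) = uniformOn {x, y}) (n : ℕ)
    (w : Fin n → Round K) (f : Fin K → Fin K → ENNReal) :
    ∫⁻ z, f z.pm z.ac ∂M.roundKernel π n w
      = ∫⁻ a, (ENNReal.ofReal (trust M.trustSet (fun i => (w i).pm) n : ℝ) * f a a
        + ENNReal.ofReal (1 - (trust M.trustSet (fun i => (w i).pm) n : ℝ))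
          * (2⁻¹ * (f a x + f a y))) ∂π.kernel n (fun i => (w i).obs) := by
  have h := M.lintegral_roundKernel π n w fun a b o => f a (if b = true then a else o)
  rw [show (fun z : Round K => f z.pm z.ac)
    = fun z => f z.pm (if z.chi = true then z.pm else z.own) from rfl, h]
  refine lintegral_congr fun a => ?_
  rw [M.lintegral_chiKernel n w, hown, lintegral_uniformOn_pair hxy, lintegral_uniformOn_pair hxy,
    if_pos rfl, if_pos rfl, ← two_mul, ← mul_assoc 2⁻¹,
    ENNReal.inv_mul_cancel two_ne_zero ENNReal.ofNat_ne_top, one_mul]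
  simp

end TrustBandit

/-! ### Trust along a sequence of recommendations -/

section Trust

variable {K n : ℕ} (T : Finset (Fin K))

lemma alpha_zero (a : Fin n → Fin K) : alpha T a 0 = 1 := by simp [alpha]

lemma alpha_add_beta (a : Fin n → Fin K) {j : ℕ} (hj : j ≤ n) :
    alpha T a j + beta T a j = j + 2 := by
  have h : (Finset.univ.filter fun i : Fin n => (i : ℕ) < j ∧ a i ∈ T).card
      + (Finset.univ.filter fun i : Fin n => (i : ℕ) < j ∧ a i ∉ T).card = j := by
    rw [← Finset.filter_filter, ← Finset.filter_filter, Finset.card_filter_add_card_filter_not,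
      Fin.card_filter_val_lt, min_eq_right hj]
  unfold alpha beta
  omega

lemma coe_trust (a : Fin n → Fin K) {j : ℕ} (hj : j ≤ n) :
    (trust T a j : ℝ) = alpha T a j / (j + 2) := by
  have h : (alpha T a j : ℝ) + beta T a j = j + 2 := by exact_mod_cast alpha_add_beta T a hj
  simp only [trust, h]

lemma alpha_mono (a : Fin n → Fin K) : Monotone (alpha T a) := fun i j hij => by
  unfold alpha
  gcongr 1 + Finset.card ?_
  exact Finset.monotone_filter_right _ fun k _ hk => ⟨hk.1.trans_le hij, hk.2⟩

lemma alpha_le (a : Fin n → Fin K) {j : ℕ} (hj : j ≤ n) : alpha T a j ≤ j + 1 := by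
  have := alpha_add_beta T a hj
  have : 1 ≤ beta T a j := by simp [beta]
  omega

/-- If no recommendation in `T` is made after the first `m` rounds, then `α` is at most `m + 1`. -/
lemma alpha_le_of_forall_notMem (a : Fin n → Fin K) {m : ℕ} (h : ∀ i : Fin n, m ≤ i → a i ∉ T)
    (j : ℕ) : alpha T a j ≤ m + 1 := by
  have h1 : (Finset.univ.filter fun i : Fin n => (i : ℕ) < j ∧ a i ∈ T).card
      ≤ (Finset.univ.filter fun i : Fin n => (i : ℕ) < m).card := by
    refine Finset.card_le_card fun i hi => ?_
    simp only [Finset.mem_filter, Finset.mem_univ, true_and] at hi ⊢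
    by_contra hm
    exact h i (not_lt.1 hm) hi.2
  rw [Fin.card_filter_val_lt] at h1
  unfold alpha
  omega

lemma alpha_snoc (a : Fin n → Fin K) (x : Fin K) {j : ℕ} (hj : j ≤ n) :
    alpha T (Fin.snoc a x : Fin (n + 1) → Fin K) j = alpha T a j := by
  unfold alpha
  simp only [Finset.card_filter, Fin.sum_univ_castSucc, Fin.snoc_castSucc, Fin.snoc_last,
    Fin.val_castSucc, Fin.val_last]
  simp [not_lt.2 hj]

lemma alpha_snoc_succ (a : Fin n → Fin K) (x : Fin K) :
    alpha T (Fin.snoc a x : Fin (n + 1) → Fin K) (n + 1)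
      = alpha T a n + if x ∈ T then 1 else 0 := by
  unfold alpha
  simp only [Finset.card_filter, Fin.sum_univ_castSucc, Fin.snoc_castSucc, Fin.snoc_last,
    Fin.val_castSucc, Fin.val_last]
  have h (i : Fin n) : (i : ℕ) < n + 1 := by omega
  simp [h, add_assoc]

lemma trust_snoc (a : Fin n → Fin K) (x : Fin K) {j : ℕ} (hj : j ≤ n) :
    trust T (Fin.snoc a x : Fin (n + 1) → Fin K) j = trust T a j := by
  ext
  rw [coe_trust _ _ hj, coe_trust _ _ (by omega), alpha_snoc _ _ _ hj]

/-- The sum of the trust levels over the rounds with a recommendation outside `T`. -/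
def outsideTrust (a : Fin n → Fin K) : ℝ :=
  ∑ i : Fin n, if a i ∈ T then 0 else (trust T a i : ℝ)

lemma outsideTrust_snoc (a : Fin n → Fin K) (x : Fin K) :
    outsideTrust T (Fin.snoc a x : Fin (n + 1) → Fin K)
      = outsideTrust T a + if x ∈ T then 0 else (trust T a n : ℝ) := by
  simp only [outsideTrust, Fin.sum_univ_castSucc, Fin.snoc_castSucc, Fin.snoc_last,
    Fin.val_castSucc, Fin.val_last]
  rw [trust_snoc _ _ _ le_rfl]
  congr 1
  refine Finset.sum_congr rfl fun i _ => ?_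
  rw [trust_snoc _ _ _ i.2.le]

/-- Recommendations in `T` raise the trust level but do not enter the sum, and the others lower the
trust level: hence on average at most half a unit per round is collected. The potential
`(n + 2) / 2 - α ^ 2 / (2 * (n + 1))` dominates the sum because, with `t = α / (n + 2)`, it grows by
at least `(1 + t ^ 2) / 2 ≥ t` in a round that counts, and does not decrease in the others. -/
lemma outsideTrust_le_potential (a : Fin n → Fin K) :
    outsideTrust T a ≤ (n + 2) / 2 - (alpha T a n : ℝ) ^ 2 / (2 * (n + 1)) := by
  induction n with
  | zero => norm_num [outsideTrust, alpha_zero]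
  | succ n ih =>
    obtain ⟨b, x, rfl⟩ : ∃ (b : Fin n → Fin K) (x : Fin K), a = Fin.snoc b x :=
      ⟨Fin.init a, a (Fin.last n), (Fin.snoc_init_self a).symm⟩
    have hb := ih b
    have h1 : (alpha T b n : ℝ) ≤ n + 1 := by exact_mod_cast alpha_le T b le_rfl
    rw [outsideTrust_snoc, alpha_snoc_succ, coe_trust _ _ le_rfl]
    clear ih
    generalize (alpha T b n : ℕ) = α at *
    have hn : (0 : ℝ) ≤ n := n.cast_nonneg
    push_cast
    generalize (n : ℝ) = m at *
    refine (add_le_add_left hb _).trans ?_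
    split_ifs with hx
    · have : (α + 1 : ℝ) ^ 2 / (2 * (m + 1 + 1)) ≤ 1 / 2 + (α : ℝ) ^ 2 / (2 * (m + 1)) := by
        rw [div_add_div _ _ (by positivity) (by positivity),
          div_le_div_iff₀ (by positivity) (by positivity)]
        nlinarith [mul_nonneg hn (sq_nonneg (m + 1 - α)), sq_nonneg (m + 1 - α)]
      linarith
    · have : (α : ℝ) / (m + 2) + (α : ℝ) ^ 2 / (2 * (m + 1 + 1))
          ≤ 1 / 2 + (α : ℝ) ^ 2 / (2 * (m + 1)) := by
        rw [div_add_div _ _ (by positivity) (by positivity),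
          div_add_div _ _ (by positivity) (by positivity), div_le_div_iff₀ (by positivity)
            (by positivity)]
        nlinarith [mul_nonneg hn (sq_nonneg (m + 2 - α)), sq_nonneg (m + 2 - α)]
      rw [add_zero]
      linarith

lemma outsideTrust_le_half (a : Fin n → Fin K) : outsideTrust T a ≤ (n + 2) / 2 := by
  have h := outsideTrust_le_potential T a
  have : 0 ≤ (alpha T a n : ℝ) ^ 2 / (2 * (n + 1)) := by positivity
  linarith

lemma sum_inv_add_two_le_log (n : ℕ) :
    ∑ j ∈ Finset.range n, (1 : ℝ) / (j + 2) ≤ Real.log (n + 1) := by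
  induction n with
  | zero => simp
  | succ n ih =>
    rw [Finset.sum_range_succ]
    have h := Real.one_sub_inv_le_log_of_pos (x := ((n : ℝ) + 2) / (n + 1)) (by positivity)
    rw [Real.log_div (by positivity) (by positivity), inv_div] at h
    have e : 1 - ((n : ℝ) + 1) / (n + 2) = 1 / (n + 2) := by field_simp; ring
    rw [e] at h
    push_cast
    rw [show (n : ℝ) + 1 + 1 = n + 2 by ring]
    linarith

/-- If `α` stays below `m`, the trust levels decay like `m / j`, and their sum is logarithmic. -/
lemma sum_trust_le (a : Fin n → Fin K) {m : ℝ} (h : (alpha T a n : ℝ) ≤ m) :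
    ∑ j ∈ Finset.range n, (trust T a j : ℝ) ≤ m * Real.log (n + 1) := by
  have hm : 0 ≤ m := (Nat.cast_nonneg _).trans h
  refine le_trans ?_ (mul_le_mul_of_nonneg_left (sum_inv_add_two_le_log n) hm)
  rw [Finset.mul_sum]
  refine Finset.sum_le_sum fun j hj => ?_
  have hj := (Finset.mem_range.1 hj).le
  rw [coe_trust _ _ hj, mul_one_div]
  gcongr
  exact le_trans (by exact_mod_cast alpha_mono T a hj) h

lemma outsideTrust_le_sum_trust (a : Fin n → Fin K) :
    outsideTrust T a ≤ ∑ j ∈ Finset.range n, (trust T a j : ℝ) := by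
  rw [← Fin.sum_univ_eq_sum_range fun j => (trust T a j : ℝ), outsideTrust]
  refine Finset.sum_le_sum fun i _ => ?_
  split_ifs
  · exact (trust T a i).2.1
  · exact le_rfl

end Trust

/-! ### An exponential supermartingale for the numbers of pulls -/

/-- The number of pulls of arms in `s` along a history. -/
def pullsIn {K n : ℕ} (s : Finset (Fin K)) (w : Fin n → Round K) : ℕ :=
  (Finset.univ.filter fun i => (w i).ac ∈ s).card

section Pulls

variable {K n : ℕ}

lemma pullsIn_snoc (s : Finset (Fin K)) (w : Fin n → Round K) (z : Round K) :
    pullsIn s (Fin.snoc w z : Fin (n + 1) → Round K) = pullsIn s w + if z.ac ∈ s then 1 else 0 := by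
  simp only [pullsIn, Finset.card_filter, Fin.sum_univ_castSucc, Fin.snoc_castSucc, Fin.snoc_last]

lemma pm_snoc (w : Fin n → Round K) (z : Round K) :
    (fun i => (Fin.snoc w z : Fin (n + 1) → Round K) i |>.pm)
      = (Fin.snoc (fun i => (w i).pm) z.pm : Fin (n + 1) → Fin K) := by
  funext i
  refine Fin.lastCases ?_ (fun j => ?_) i <;> simp

@[fun_prop]
lemma measurable_pullsIn (s : Finset (Fin K)) :
    Measurable (pullsIn s : (Fin n → Round K) → ℕ) := by
  have h : Measurable fun a : Fin n → Fin K => (Finset.univ.filter fun i => a i ∈ s).card :=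
    measurable_of_countable _
  exact h.comp (by fun_prop : Measurable fun (w : Fin n → Round K) i => (w i).ac)

lemma measurable_comp_pm {β : Type*} [MeasurableSpace β] (f : (Fin n → Fin K) → β) :
    Measurable fun w : Fin n → Round K => f fun i => (w i).pm :=
  (measurable_of_countable f).comp
    (by fun_prop : Measurable fun (w : Fin n → Round K) i => (w i).pm)

lemma measurable_comp_pm_ac {β : Type*} [MeasurableSpace β] (f : Fin K → Fin K → β) :
    Measurable fun z : Round K => f z.pm z.ac := by
  have h : Measurable fun q : Fin K × Fin K => f q.1 q.2 := measurable_of_countable _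
  exact h.comp (Round.measurable_pm.prodMk Round.measurable_ac)

end Pulls

/-- The exponent of the supermartingale: `l` weights the pulls of the arms other than `x` and `y`,
`u` the pulls of `y`. The drift is compensated by `a` per round and by `b` times the trust level in
each round in which `y` is not recommended. -/
def exponent {K n : ℕ} (x y : Fin K) (l u a b : ℝ) (w : Fin n → Round K) : ℝ :=
  l * pullsIn {x, y}ᶜ w - u * pullsIn {y} w + a * n - b * outsideTrust {y} fun i => (w i).pm

/-- The increment of `exponent` in a round with trust level `t` in which `p` is recommended and `c` is
pulled. -/
def roundExponent {K : ℕ} (x y : Fin K) (l u a b t : ℝ) (p c : Fin K) : ℝ :=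
  l * (if c ∈ ({x, y} : Finset (Fin K))ᶜ then 1 else 0)
    - u * (if c ∈ ({y} : Finset (Fin K)) then 1 else 0)
    + a - b * (if p ∈ ({y} : Finset (Fin K)) then 0 else t)

lemma exponent_snoc {K n : ℕ} (x y : Fin K) (l u a b : ℝ) (w : Fin n → Round K) (z : Round K) :
    exponent x y l u a b (Fin.snoc w z : Fin (n + 1) → Round K)
      = exponent x y l u a b w
        + roundExponent x y l u a b (trust {y} (fun i => (w i).pm) n) z.pm z.ac := by
  simp only [exponent, roundExponent, pullsIn_snoc, pm_snoc, outsideTrust_snoc]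
  push_cast
  ring

/-- The exponential moment of `roundExponent` is at most one whatever is recommended: if it is `y`,
then `y` is pulled with probability at least `1 / 2` and no arm other than `x` and `y` is; otherwise
an arm other than `x` and `y` is pulled with probability at most `t`, and `y` with probability at
least `(1 - t) / 2`. -/
lemma exp_roundExponent_le_one {K : ℕ} {x y : Fin K} (hxy : x ≠ y) {l u a b : ℝ}
    (hl : 0 ≤ l) (hu : 0 ≤ u) (hy : (1 + Real.exp (-u)) / 2 ≤ Real.exp (-a))
    (hny : ∀ t ∈ Set.Icc (0 : ℝ) 1,
      t * Real.exp l + (1 - t) * ((1 + Real.exp (-u)) / 2) ≤ Real.exp (b * t - a))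
    {t : ℝ} (ht : t ∈ Set.Icc (0 : ℝ) 1) (p : Fin K) :
    t * Real.exp (roundExponent x y l u a b t p p)
      + (1 - t) * (1 / 2 * (Real.exp (roundExponent x y l u a b t p x)
        + Real.exp (roundExponent x y l u a b t p y))) ≤ 1 := by
  have ht0 := ht.1
  have hexp : Real.exp (-u) ≤ 1 := Real.exp_le_one_iff.2 (by linarith)
  rcases eq_or_ne p y with rfl | hp
  · have h1 : roundExponent x p l u a b t p p = -u + a := by simp [roundExponent]
    have h3 : roundExponent x p l u a b t p x = a := by simp [roundExponent, hxy]
    rw [h1, h3, Real.exp_add]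
    have hea : Real.exp (-a) * Real.exp a = 1 := by rw [← Real.exp_add]; simp
    have h4 := mul_le_mul_of_nonneg_right hy (Real.exp_nonneg a)
    have h5 := mul_nonneg (mul_nonneg ht0 (sub_nonneg.2 hexp)) (Real.exp_nonneg a)
    linarith
  · have hpp : Real.exp (roundExponent x y l u a b t p p)
        ≤ Real.exp l * Real.exp (a - b * t) := by
      rw [← Real.exp_add, Real.exp_le_exp]
      simp only [roundExponent, Finset.mem_singleton, hp, if_false]
      split_ifs <;> linarith
    have hx : roundExponent x y l u a b t p x = a - b * t := by simp [roundExponent, hp, hxy]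
    have hy' : roundExponent x y l u a b t p y = -u + (a - b * t) := by
      simp [roundExponent, hp]; ring
    rw [hx, hy', Real.exp_add]
    have h3 := mul_le_mul_of_nonneg_right (hny t ht) (Real.exp_nonneg (a - b * t))
    rw [← Real.exp_add, show b * t - a + (a - b * t) = 0 by ring, Real.exp_zero] at h3
    have h4 := mul_le_mul_of_nonneg_left hpp ht0
    linarith

namespace TrustBandit

variable {K : ℕ} (M : TrustBandit K) (π : Policy K)

lemma measurable_exponent {n : ℕ} (x y : Fin K) (l u a b : ℝ) :
    Measurable (exponent x y l u a b : (Fin n → Round K) → ℝ) := by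
  have h1 : Measurable fun w : Fin n → Round K => (pullsIn {x, y}ᶜ w : ℝ) := by fun_prop
  have h2 : Measurable fun w : Fin n → Round K => (pullsIn {y} w : ℝ) := by fun_prop
  exact (((h1.const_mul l).sub (h2.const_mul u)).add_const _).sub
    ((measurable_comp_pm _).const_mul b)

variable {M} in
lemma lintegral_exp_exponent_snoc_le {x y : Fin K} (hxy : x ≠ y) (hT : M.trustSet = {y})
    (hown : ∀ n, (M.ownPolicy n : Measure (Fin K)) = uniformOn {x, y}) {l u a b : ℝ}
    (hl : 0 ≤ l) (hu : 0 ≤ u) (hy : (1 + Real.exp (-u)) / 2 ≤ Real.exp (-a))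
    (hny : ∀ t ∈ Set.Icc (0 : ℝ) 1,
      t * Real.exp l + (1 - t) * ((1 + Real.exp (-u)) / 2) ≤ Real.exp (b * t - a))
    (n : ℕ) (w : Fin n → Round K) :
    ∫⁻ z, ENNReal.ofReal (Real.exp (exponent x y l u a b (Fin.snoc w z : Fin (n + 1) → Round K)))
        ∂M.roundKernel π n w
      ≤ ENNReal.ofReal (Real.exp (exponent x y l u a b w)) := by
  have ht := (trust {y} (fun i => (w i).pm) n).2
  simp_rw [exponent_snoc, Real.exp_add, ENNReal.ofReal_mul (Real.exp_nonneg _)]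
  have hint (t : ℝ) := M.lintegral_roundKernel_pm_ac π hxy hown n w
    fun p c => ENNReal.ofReal (Real.exp (roundExponent x y l u a b t p c))
  simp only [hT] at hint
  generalize (trust {y} (fun i => (w i).pm) n : ℝ) = t at ht hint ⊢
  have hm : Measurable fun z : Round K =>
      ENNReal.ofReal (Real.exp (roundExponent x y l u a b t z.pm z.ac)) :=
    measurable_comp_pm_ac fun p c => ENNReal.ofReal (Real.exp (roundExponent x y l u a b t p c))
  rw [lintegral_const_mul _ hm, hint]
  refine mul_le_of_le_one_right' ?_
  have ht0 := ht.1
  have ht1 : 0 ≤ 1 - t := sub_nonneg.2 ht.2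
  refine (lintegral_mono (g := fun _ => 1) fun p => ?_).trans (by simp)
  have h2 : (2⁻¹ : ENNReal) = ENNReal.ofReal (1 / 2) := by
    rw [one_div, ENNReal.ofReal_inv_of_pos two_pos]; simp
  rw [h2, ← ENNReal.ofReal_add (Real.exp_nonneg _) (Real.exp_nonneg _),
    ← ENNReal.ofReal_mul ht0, ← ENNReal.ofReal_mul (p := 1 / 2) (by norm_num),
    ← ENNReal.ofReal_mul ht1,
    ← ENNReal.ofReal_add (mul_nonneg ht0 (Real.exp_nonneg _)) (mul_nonneg ht1 (by positivity))]
  exact ENNReal.ofReal_le_one.2 (exp_roundExponent_le_one hxy hl hu hy hny ht p)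

variable {M} in
lemma law_le_exponent_le {x y : Fin K} (hxy : x ≠ y) (hT : M.trustSet = {y})
    (hown : ∀ n, (M.ownPolicy n : Measure (Fin K)) = uniformOn {x, y}) {l u a b : ℝ}
    (hl : 0 ≤ l) (hu : 0 ≤ u) (hy : (1 + Real.exp (-u)) / 2 ≤ Real.exp (-a))
    (hny : ∀ t ∈ Set.Icc (0 : ℝ) 1,
      t * Real.exp l + (1 - t) * ((1 + Real.exp (-u)) / 2) ≤ Real.exp (b * t - a))
    (n : ℕ) (c : ℝ) :
    M.law π n {w | c ≤ exponent x y l u a b w} ≤ ENNReal.ofReal (Real.exp (-c)) := by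
  have hm (n : ℕ) : Measurable fun w : Fin n → Round K =>
      ENNReal.ofReal (Real.exp (exponent x y l u a b w)) :=
    (measurable_exponent x y l u a b).exp.ennreal_ofReal
  have h1 := M.lintegral_law_le_of_supermartingale π hm
    (lintegral_exp_exponent_snoc_le π hxy hT hown hl hu hy hny) n
  have h2 : ENNReal.ofReal (Real.exp (exponent x y l u a b
      (Fin.elim0 : Fin 0 → Round K))) = 1 := by
    simp [exponent, pullsIn, outsideTrust]
  rw [h2] at h1
  have h3 := (mul_meas_ge_le_lintegral (μ := M.law π n) (hm n)
    (ENNReal.ofReal (Real.exp c))).trans h1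
  have h4 : {w | c ≤ exponent x y l u a b w}
      ⊆ {w : Fin n → Round K | ENNReal.ofReal (Real.exp c)
        ≤ ENNReal.ofReal (Real.exp (exponent x y l u a b w))} := fun w hw =>
    ENNReal.ofReal_le_ofReal (Real.exp_le_exp.2 hw)
  have h5 : ENNReal.ofReal (Real.exp c) * M.law π n {w | c ≤ exponent x y l u a b w} ≤ 1 :=
    (mul_le_mul_right (measure_mono h4) _).trans h3
  rw [Real.exp_neg, ENNReal.ofReal_inv_of_pos (Real.exp_pos c)]
  rw [ENNReal.le_inv_iff_mul_le]
  rwa [mul_comm]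

end TrustBandit

/-! ### When UCB recommends an arm -/

lemma pullCount_obs {K n : ℕ} (w : Fin n → Round K) (a : Fin K) :
    pullCount (fun i => (w i).obs) a = max 1 (pullsIn {a} w) := by
  simp only [pullCount, pullsIn, Round.obs, Finset.mem_singleton]
  congr

lemma sum_pullsIn_singleton {K n : ℕ} (s : Finset (Fin K)) (w : Fin n → Round K) :
    ∑ a ∈ s, pullsIn {a} w = pullsIn s w := by
  rw [pullsIn, Finset.card_eq_sum_card_fiberwise (f := fun i => (w i).ac) (t := s)
    fun i hi => by simpa using hi]
  refine Finset.sum_congr rfl fun a ha => ?_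
  rw [pullsIn]
  congr 1
  ext i
  simp only [Finset.mem_singleton, Finset.mem_filter, Finset.mem_univ, true_and]
  exact ⟨fun h => ⟨h ▸ ha, h⟩, And.right⟩

/-- If `y` has maximal index, then, up to the threshold `B` at which its mean reward outweighs the
exploration bonus, every other arm has been pulled at least a quarter as often as `y`. -/
lemma min_pullCount_le_of_mem_ucbArgmax {K n H : ℕ} (hn : n ≠ 0) {o : Fin n → Obs K} {y : Fin K}
    {ρ B : ℝ} (hL : 0 < Real.log H) (hρ : 0 ≤ ρ) (hB : 0 < B)
    (hρB : ρ ≤ 2 * √(Real.log H / B)) (h0 : ∀ i, 0 ≤ (o i).2.1)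
    (hy : ∀ i, (o i).1 = y → (o i).2.1 ≤ ρ) (hmem : y ∈ ucbArgmax H o) (a : Fin K) :
    min (pullCount o y : ℝ) B ≤ 4 * pullCount o a := by
  set L := Real.log H
  have hN (c : Fin K) : (0 : ℝ) < pullCount o c := by
    have : 0 < pullCount o c := lt_of_lt_of_le one_pos (le_max_left _ _)
    exact_mod_cast this
  have h1 : 2 * √(L / pullCount o a) ≤ ucbIndex H o a := by
    rw [ucbIndex, if_neg hn]
    refine le_add_of_nonneg_left (div_nonneg (Finset.sum_nonneg fun i _ => ?_) (hN a).le)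
    split_ifs
    exacts [h0 i, le_rfl]
  have h2 : ucbIndex H o y ≤ ρ + 2 * √(L / pullCount o y) := by
    rw [ucbIndex, if_neg hn]
    refine add_le_add_left ?_ _
    rw [div_le_iff₀ (hN y)]
    calc ∑ i, (if (o i).1 = y then (o i).2.1 else 0)
        ≤ ∑ i, if (o i).1 = y then ρ else 0 := by
          refine Finset.sum_le_sum fun i _ => ?_
          split_ifs with h
          exacts [hy i h, le_rfl]
      _ = (Finset.univ.filter fun i => (o i).1 = y).card * ρ := by
          rw [← Finset.sum_filter, Finset.sum_const, nsmul_eq_mul]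
      _ ≤ pullCount o y * ρ := by
          gcongr
          exact le_max_right _ _
      _ = ρ * pullCount o y := mul_comm _ _
  set m := min (pullCount o y : ℝ) B with hm
  have hm0 : 0 < m := lt_min (hN y) hB
  have h3 : √(L / pullCount o y) ≤ √(L / m) := by gcongr; exact min_le_left _ _
  have h4 : √(L / B) ≤ √(L / m) := by gcongr; exact min_le_right _ _
  have h5 : √(L / pullCount o a) ≤ 2 * √(L / m) := by linarith [hmem a]
  have h6 : L / pullCount o a ≤ 4 * (L / m) := by
    have := pow_le_pow_left₀ (Real.sqrt_nonneg _) h5 2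
    rw [mul_pow, Real.sq_sqrt (div_pos hL (hN a)).le, Real.sq_sqrt (div_pos hL hm0).le] at this
    linarith
  rw [← mul_div_assoc, div_le_div_iff₀ (hN a) hm0] at h6
  exact le_of_mul_le_mul_left (by linarith) hL

/-- If UCB recommends `y`, then the arms of any set `s` have together been pulled about `#s / 4`
times as often as `y`, up to the threshold `B`. -/
lemma card_mul_min_le_of_mem_ucbArgmax {K n H : ℕ} (hn : n ≠ 0) {w : Fin n → Round K} {y : Fin K}
    {ρ B : ℝ} (hL : 0 < Real.log H) (hρ : 0 ≤ ρ) (hB : 0 < B)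
    (hρB : ρ ≤ 2 * √(Real.log H / B)) (h0 : ∀ i a, 0 ≤ (w i).rewards a)
    (hy : ∀ i, (w i).rewards y ≤ ρ) (hmem : y ∈ ucbArgmax H fun i => (w i).obs)
    (s : Finset (Fin K)) :
    s.card * (min (pullsIn {y} w : ℝ) B - 4) ≤ 4 * pullsIn s w := by
  have key : ∀ a ∈ s, min (pullsIn {y} w : ℝ) B - 4 ≤ 4 * pullsIn {a} w := by
    intro a _
    have h := min_pullCount_le_of_mem_ucbArgmax hn hL hρ hB hρB
      (o := fun i => (w i).obs) (fun i => h0 i _) (by rintro i rfl; exact hy i) hmem a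
    rw [pullCount_obs, pullCount_obs] at h
    have h1 : min (pullsIn {y} w : ℝ) B ≤ min ((max 1 (pullsIn {y} w) : ℕ) : ℝ) B :=
      min_le_min_right _ (by exact_mod_cast le_max_right _ _)
    have h2 : ((max 1 (pullsIn {a} w) : ℕ) : ℝ) ≤ pullsIn {a} w + 1 := by
      exact_mod_cast max_le (by omega) (by omega)
    linarith
  rw [← sum_pullsIn_singleton s w]
  push_cast
  rw [Finset.mul_sum, ← nsmul_eq_mul]
  exact Finset.card_nsmul_le_sum _ _ _ key

namespace TrustBandit

variable {K : ℕ} (M : TrustBandit K) (π : Policy K)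

/-- Some recommendation after the first `m` rounds is `y`. -/
def lateRec {n : ℕ} (y : Fin K) (m : ℕ) : Set (Fin n → Round K) :=
  {w | ∃ i : Fin n, m ≤ i ∧ (w i).pm = y}

lemma measurableSet_lateRec {n : ℕ} (y : Fin K) (m : ℕ) :
    MeasurableSet (lateRec y m : Set (Fin n → Round K)) := by
  have : (lateRec y m : Set (Fin n → Round K))
      = (fun w i => (w i).pm) ⁻¹' {a : Fin n → Fin K | ∃ i : Fin n, m ≤ i ∧ a i = y} := rfl
  rw [this]
  exact (by fun_prop : Measurable fun (w : Fin n → Round K) i => (w i).pm)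
    (Set.to_countable _).measurableSet

lemma snoc_mem_lateRec {n : ℕ} {y : Fin K} {m : ℕ} {w : Fin n → Round K} {z : Round K} :
    (Fin.snoc w z : Fin (n + 1) → Round K) ∈ lateRec y m
      ↔ w ∈ lateRec y m ∨ m ≤ n ∧ z.pm = y := by
  simp [lateRec, Fin.exists_fin_succ']

lemma roundKernel_pm_ucbPolicy_eq_zero [NeZero K] {n H : ℕ} {w : Fin n → Round K} {y : Fin K}
    (h : y ∉ ucbArgmax H fun i => (w i).obs) :
    M.roundKernel (ucbPolicy K H) n w {z | z.pm = y} = 0 := by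
  have hm : MeasurableSet {z : Round K | z.pm = y} :=
    Round.measurable_pm (measurableSet_singleton y)
  have e := M.lintegral_roundKernel (ucbPolicy K H) n w fun p _ _ => if p = y then 1 else 0
  have e1 : ∫⁻ z, (if Round.pm z = y then 1 else 0) ∂M.roundKernel (ucbPolicy K H) n w
      = M.roundKernel (ucbPolicy K H) n w {z | z.pm = y} := by
    rw [← lintegral_indicator_one hm]
    exact lintegral_congr fun z => by simp [Set.indicator_apply]
  rw [← e1, e]
  simp only [lintegral_const, measure_univ, mul_one]
  have e2 : ∫⁻ p, (if p = y then 1 else 0) ∂(ucbPolicy K H).kernel n (fun i => (w i).obs)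
      = (ucbPolicy K H).kernel n (fun i => (w i).obs) {y} := by
    rw [← lintegral_indicator_one (measurableSet_singleton y)]
    exact lintegral_congr fun z => by simp [Set.indicator_apply]
  rw [e2]
  change uniformOn (ucbArgmax H fun i => (w i).obs) {y} = 0
  rw [uniformOn_eq_zero_iff (Set.toFinite _)]
  simpa using h

/-- A first late recommendation of `y` is made in a round in which `y` has maximal index. -/
lemma law_succ_lateRec_le [NeZero K] (H : ℕ) (y : Fin K) (m n : ℕ) :
    M.law (ucbPolicy K H) (n + 1) (lateRec y m)
      ≤ M.law (ucbPolicy K H) n (lateRec y m)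
        + M.law (ucbPolicy K H) n
          {w | w ∉ lateRec y m ∧ m ≤ n ∧ y ∈ ucbArgmax H fun i => (w i).obs} := by
  have hm (n : ℕ) : MeasurableSet (lateRec y m : Set (Fin n → Round K)) :=
    measurableSet_lateRec y m
  set A : Set (Fin n → Round K) :=
    {w | w ∉ lateRec y m ∧ m ≤ n ∧ y ∈ ucbArgmax H fun i => (w i).obs} with hA
  have hAm : lateRec y m ∪ A ⊆ toMeasurable (M.law (ucbPolicy K H) n) (lateRec y m ∪ A) :=
    subset_toMeasurable _ _
  refine le_trans ?_ (measure_union_le _ _)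
  rw [← measure_toMeasurable (lateRec y m ∪ A), ← lintegral_indicator_one (measurableSet_toMeasurable _ _),
    ← lintegral_indicator_one (hm _),
    M.lintegral_law_succ _ _ (measurable_one.indicator (hm _))]
  refine lintegral_mono fun w => ?_
  by_cases hw : w ∈ lateRec y m ∪ A
  · rw [Set.indicator_of_mem (hAm hw)]
    refine (lintegral_mono (g := fun _ => 1) fun z => ?_).trans (by simp)
    exact Set.indicator_le_self' (fun _ _ => zero_le) _
  · refine le_of_eq_of_le ?_ zero_le
    have hwl : w ∉ lateRec y m := fun h => hw (Or.inl h)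
    have h1 : ∀ᵐ z ∂M.roundKernel (ucbPolicy K H) n w,
        (lateRec y m).indicator (1 : (Fin (n + 1) → Round K) → ENNReal) (Fin.snoc w z) = 0 := by
      by_cases hmn : m ≤ n
      · have hy : y ∉ ucbArgmax H fun i => (w i).obs := fun h => hw (Or.inr ⟨hwl, hmn, h⟩)
        have h2 : ∀ᵐ z ∂M.roundKernel (ucbPolicy K H) n w, z.pm ≠ y := by
          rw [ae_iff]
          simpa using M.roundKernel_pm_ucbPolicy_eq_zero hy
        filter_upwards [h2] with z hz
        refine Set.indicator_of_notMem ?_ _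
        rw [snoc_mem_lateRec]
        tauto
      · refine Filter.Eventually.of_forall fun z => Set.indicator_of_notMem ?_ _
        rw [snoc_mem_lateRec]
        tauto
    rw [lintegral_congr_ae h1, lintegral_zero]

/-- Union bound over the round of the first late recommendation. -/
lemma law_lateRec_le [NeZero K] (H : ℕ) (y : Fin K) (m : ℕ) {δ : ENNReal} {N : ℕ}
    (h : ∀ n, m ≤ n → n < N → M.law (ucbPolicy K H) n
      {w | w ∉ lateRec y m ∧ y ∈ ucbArgmax H fun i => (w i).obs} ≤ δ) {n : ℕ} (hn : n ≤ N) :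
    M.law (ucbPolicy K H) n (lateRec y m) ≤ n * δ := by
  induction n with
  | zero =>
    have : (lateRec y m : Set (Fin 0 → Round K)) = ∅ := by ext w; simp [lateRec]
    simp [this]
  | succ n ih =>
    refine (M.law_succ_lateRec_le H y m n).trans ?_
    rw [Nat.cast_succ, add_mul, one_mul]
    refine add_le_add (ih (by omega)) ?_
    by_cases hmn : m ≤ n
    · refine (measure_mono fun w hw => ?_).trans (h n hmn (by omega))
      exact ⟨hw.1, hw.2.2⟩
    · simp [hmn]

end TrustBandit

/-! ### UCB does not recommend the good arm after a logarithmic number of rounds -/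

lemma exp_neg_sixteen_fifths_le : Real.exp (-(16 / 5)) ≤ 1 / 16 := by
  have h1 : (2 : ℝ) ≤ Real.exp (4 / 5) := by
    have := Real.quadratic_le_exp_of_nonneg (x := 4 / 5) (by norm_num)
    linarith
  have h2 := pow_le_pow_left₀ zero_le_two h1 4
  rw [← Real.exp_nat_mul] at h2
  rw [Real.exp_neg, one_div]
  refine inv_anti₀ (by norm_num) ?_
  norm_num at h2 ⊢
  exact h2

lemma seventeen_div_le_exp : (17 / 32 : ℝ) ≤ Real.exp (-(3 / 5)) := by
  have h1 : (9 / 10 : ℝ) ≤ Real.exp (-(1 / 10)) := by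
    have := Real.add_one_le_exp (-(1 / 10) : ℝ)
    linarith
  have h2 := pow_le_pow_left₀ (by norm_num) h1 6
  rw [← Real.exp_nat_mul] at h2
  norm_num at h2 ⊢
  linarith

lemma exp_one_div_twenty_le : Real.exp (1 / 20) ≤ 17 / 16 := by
  have h1 := Real.add_one_le_exp (-(1 / 20) : ℝ)
  rw [Real.exp_neg] at h1
  have h2 : (Real.exp (1 / 20)) * (Real.exp (1 / 20))⁻¹ = 1 :=
    mul_inv_cancel₀ (Real.exp_pos _).ne'
  nlinarith [Real.exp_pos (1 / 20 : ℝ)]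

namespace TrustBandit

variable {K : ℕ} {M : TrustBandit K} (π : Policy K) {x y : Fin K}

/-- Large deviations of the numbers of pulls in the regime in which `y` is still recommended often
enough to be compared with the other arms. -/
lemma law_le_exponent_le_of_comparison (hxy : x ≠ y) (hT : M.trustSet = {y})
    (hown : ∀ n, (M.ownPolicy n : Measure (Fin K)) = uniformOn {x, y}) (n : ℕ) (c : ℝ) :
    M.law π n {w | c ≤ exponent x y (1 / 20) (16 / 5) (3 / 5) 1 w}
      ≤ ENNReal.ofReal (Real.exp (-c)) := by
  have h := exp_neg_sixteen_fifths_le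
  have h1 := seventeen_div_le_exp
  refine law_le_exponent_le π hxy hT hown (by norm_num) (by norm_num) (by linarith) ?_ n c
  rintro t ⟨ht0, ht1⟩
  have h2 := exp_one_div_twenty_le
  have h3 := Real.add_one_le_exp t
  calc t * Real.exp (1 / 20) + (1 - t) * ((1 + Real.exp (-(16 / 5))) / 2)
      ≤ t * (17 / 16) + (1 - t) * (17 / 32) := by
        exact add_le_add (mul_le_mul_of_nonneg_left h2 ht0)
          (mul_le_mul_of_nonneg_left (by linarith) (sub_nonneg.2 ht1))
    _ = (17 / 32) * (t + 1) := by ring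
    _ ≤ Real.exp (-(3 / 5)) * Real.exp t := by gcongr
    _ = Real.exp (1 * t - 3 / 5) := by rw [← Real.exp_add]; ring_nf

/-- Large deviations of the number of pulls of the arms other than `x` and `y`. -/
lemma law_le_exponent_le_of_pulls (hxy : x ≠ y) (hT : M.trustSet = {y})
    (hown : ∀ n, (M.ownPolicy n : Measure (Fin K)) = uniformOn {x, y}) (n : ℕ) (c : ℝ) :
    M.law π n {w | c ≤ exponent x y 1 0 0 2 w} ≤ ENNReal.ofReal (Real.exp (-c)) := by
  refine law_le_exponent_le π hxy hT hown zero_le_one le_rfl (by simp) ?_ n c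
  rintro t ⟨ht0, ht1⟩
  have h1 := Real.exp_one_lt_d9
  have h2 := Real.add_one_le_exp (2 * t)
  simp only [neg_zero, Real.exp_zero, sub_zero]
  nlinarith

/-- In a late round with `y` of maximal index one of the two exponents is large: either `y` was
pulled so often that the other arms must have been pulled about `9 L (L + 1)` times each, or the numbers of
their pulls are comparable to the number of pulls of `y`. -/
lemma le_exponent_or_le_exponent {x y : Fin 260} (hxy : x ≠ y) {H : ℕ} (hH : 20 ≤ Real.log H)
    {n : ℕ} (hn : ⌈30 * Real.log H⌉₊ ≤ n) (hnH : n < H) {w : Fin n → Round 260}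
    (hr : ∀ i, (∀ a, 0 ≤ (w i).rewards a) ∧ (w i).rewards y ≤ 1 / (3 * √(Real.log H + 1)))
    (hlate : w ∉ lateRec y ⌈30 * Real.log H⌉₊) (hmem : y ∈ ucbArgmax H fun i => (w i).obs) :
    3 * Real.log H - 14 ≤ exponent x y (1 / 20) (16 / 5) (3 / 5) 1 w
      ∨ 3 * Real.log H - 14 ≤ exponent x y 1 0 0 2 w := by
  have hα := alpha_le_of_forall_notMem {y} (fun i => (w i).pm) (m := ⌈30 * Real.log H⌉₊)
    (fun i hi h => hlate ⟨i, hi, by simpa using h⟩) n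
  have hm : (⌈30 * Real.log H⌉₊ : ℝ) < 30 * Real.log H + 1 := Nat.ceil_lt_add_one (by linarith)
  have hn' : 30 * Real.log H ≤ n := Nat.ceil_le.1 hn
  have hlog : Real.log (n + 1) ≤ Real.log H :=
    Real.log_le_log (by positivity) (by exact_mod_cast hnH)
  set L := Real.log H
  have hn0 : n ≠ 0 := by
    rintro rfl
    simp only [Nat.cast_zero] at hn'
    linarith
  have hρ : 1 / (3 * √(L + 1)) ≤ 2 * √(L / (36 * L * (L + 1))) := by
    have e : L / (36 * L * (L + 1)) = (1 / 6) ^ 2 / (L + 1) := by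
      have : L + 1 ≠ 0 := by linarith
      have : L ≠ 0 := by linarith
      field_simp
      norm_num
    rw [e, Real.sqrt_div (by positivity), Real.sqrt_sq (by norm_num)]
    apply le_of_eq
    field_simp
    norm_num
  have key := card_mul_min_le_of_mem_ucbArgmax hn0 (by linarith) (by positivity) (by positivity) hρ
    (fun i => (hr i).1) (fun i => (hr i).2) hmem {x, y}ᶜ
  rw [Finset.card_compl, Finset.card_pair hxy, Fintype.card_fin,
    show ((260 - 2 : ℕ) : ℝ) = 258 by norm_num] at key
  have h1 := outsideTrust_le_half {y} fun i => (w i).pm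
  have h2 := (outsideTrust_le_sum_trust {y} fun i => (w i).pm).trans
    (sum_trust_le {y} (fun i => (w i).pm) (m := 30 * L + 2) (by
      have : (alpha {y} (fun i => (w i).pm) n : ℝ) ≤ (⌈30 * L⌉₊ : ℝ) + 1 := by exact_mod_cast hα
      linarith))
  have h3 := mul_le_mul_of_nonneg_left hlog (show 0 ≤ 30 * L + 2 by linarith)
  unfold exponent
  have hU : (0 : ℝ) ≤ pullsIn {y} w := Nat.cast_nonneg _
  rcases min_cases (pullsIn {y} w : ℝ) (36 * L * (L + 1)) with h | h
  · left
    rw [h.1] at key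
    linarith
  · right
    rw [h.1] at key
    nlinarith

/-- The probability that `y` is recommended after the first `30 log H` rounds is tiny. -/
lemma law_ucbPolicy_lateRec_le {M : TrustBandit 260} {x y : Fin 260} (hxy : x ≠ y)
    (hT : M.trustSet = {y})
    (hown : ∀ n, (M.ownPolicy n : Measure (Fin 260)) = uniformOn {x, y}) {H : ℕ}
    (hH : 20 ≤ Real.log H)
    (hr : ∀ᵐ r ∂(M.rewardLaw : Measure (Fin 260 → ℝ)),
      (∀ a, 0 ≤ r a) ∧ r y ≤ 1 / (3 * √(Real.log H + 1))) {n : ℕ} (hn : n ≤ H) :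
    M.law (ucbPolicy 260 H) n (lateRec y ⌈30 * Real.log H⌉₊)
      ≤ ENNReal.ofReal (2 * Real.exp (14 - 2 * Real.log H)) := by
  set c : ℝ := 3 * Real.log H - 14 with hc
  have hH0 : (0 : ℝ) < H := by
    rcases H.eq_zero_or_pos with rfl | h
    · norm_num at hH
    · exact_mod_cast h
  have hmeas : MeasurableSet {r : Fin 260 → ℝ |
      (∀ a, 0 ≤ r a) ∧ r y ≤ 1 / (3 * √(Real.log H + 1))} := by
    measurability
  have h := M.law_lateRec_le H y ⌈30 * Real.log H⌉₊ (N := H)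
    (δ := ENNReal.ofReal (Real.exp (-c)) + ENNReal.ofReal (Real.exp (-c))) (by
      intro n hn hnH
      refine le_trans ?_ (add_le_add
        (law_le_exponent_le_of_comparison (ucbPolicy 260 H) hxy hT hown n c)
        (law_le_exponent_le_of_pulls (ucbPolicy 260 H) hxy hT hown n c))
      refine le_trans (measure_mono_ae ?_) (measure_union_le _ _)
      have hae := M.ae_law_forall (ucbPolicy 260 H) (Round.measurable_rewards hmeas)
        (M.ae_roundKernel_rewards (ucbPolicy 260 H) hmeas hr) n
      filter_upwards [hae] with w hw hmem
      exact le_exponent_or_le_exponent hxy hH hn hnH hw hmem.1 hmem.2) hn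
  refine h.trans ?_
  rw [← ENNReal.ofReal_add (Real.exp_nonneg _) (Real.exp_nonneg _), ← ENNReal.ofReal_natCast,
    ← ENNReal.ofReal_mul (Nat.cast_nonneg _)]
  refine ENNReal.ofReal_le_ofReal ?_
  calc (n : ℝ) * (Real.exp (-c) + Real.exp (-c))
      ≤ H * (Real.exp (-c) + Real.exp (-c)) := by gcongr
    _ = Real.exp (Real.log H) * (Real.exp (-c) + Real.exp (-c)) := by rw [Real.exp_log hH0]
    _ = 2 * Real.exp (14 - 2 * Real.log H) := by
      rw [← two_mul, mul_left_comm, ← Real.exp_add, hc]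
      ring_nf

end TrustBandit

/-! ### The expected regret -/

namespace TrustBandit

variable {K : ℕ} {M : TrustBandit K} (π : Policy K) {x y : Fin K}

/-- In each round the implementer pulls `x` instead of `y` with probability at least half of her
current distrust. -/
lemma lintegral_pullsIn_compl_succ_ge (hxy : x ≠ y) (hT : M.trustSet = {y})
    (hown : ∀ n, (M.ownPolicy n : Measure (Fin K)) = uniformOn {x, y}) (n : ℕ) :
    ∫⁻ w, (pullsIn {y}ᶜ w : ENNReal) ∂M.law π n
        + ∫⁻ w, ENNReal.ofReal (1 - (trust {y} (fun i => (w i).pm) n : ℝ)) * 2⁻¹ ∂M.law π n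
      ≤ ∫⁻ w, (pullsIn {y}ᶜ w : ENNReal) ∂M.law π (n + 1) := by
  have hm (n : ℕ) : Measurable fun w : Fin n → Round K => (pullsIn {y}ᶜ w : ENNReal) := by
    fun_prop
  rw [M.lintegral_law_succ π n (hm _), ← lintegral_add_left (hm _)]
  refine lintegral_mono fun w => ?_
  simp only [pullsIn_snoc]
  have hm2 := measurable_comp_pm_ac fun (_ c : Fin K) =>
    (((if c ∈ ({y} : Finset (Fin K))ᶜ then 1 else 0 : ℕ) : ENNReal))
  push_cast at hm2 ⊢
  rw [lintegral_add_right _ hm2, lintegral_const, measure_univ, mul_one]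
  gcongr
  have e := M.lintegral_roundKernel_pm_ac π hxy hown n w
    fun (_ c : Fin K) => if c ∈ ({y} : Finset (Fin K))ᶜ then 1 else 0
  rw [e, hT]
  refine le_trans (by simp) (lintegral_mono
    (f := fun _ => ENNReal.ofReal (1 - (trust {y} (fun i => (w i).pm) n : ℝ)) * 2⁻¹) fun a => ?_)
  simp [hxy]

lemma lintegral_pullsIn_compl_mono (hxy : x ≠ y) (hT : M.trustSet = {y})
    (hown : ∀ n, (M.ownPolicy n : Measure (Fin K)) = uniformOn {x, y}) :
    Monotone fun n => ∫⁻ w, (pullsIn {y}ᶜ w : ENNReal) ∂M.law π n :=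
  monotone_nat_of_le_succ fun n =>
    le_self_add.trans (lintegral_pullsIn_compl_succ_ge π hxy hT hown n)

lemma lintegral_pullsIn_compl_le (n : ℕ) (s : Finset (Fin K)) :
    ∫⁻ w, (pullsIn s w : ENNReal) ∂M.law π n ≤ n := by
  refine (lintegral_mono (g := fun _ => (n : ENNReal)) fun w => ?_).trans (by simp)
  have : pullsIn s w ≤ n := (Finset.card_filter_le _ _).trans (by simp)
  exact Nat.cast_le.2 this

lemma one_div_four_le_lintegral_pullsIn_compl (hxy : x ≠ y) (hT : M.trustSet = {y})
    (hown : ∀ n, (M.ownPolicy n : Measure (Fin K)) = uniformOn {x, y}) {n : ℕ} (hn : 1 ≤ n) :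
    ENNReal.ofReal (1 / 4) ≤ ∫⁻ w, (pullsIn {y}ᶜ w : ENNReal) ∂M.law π n := by
  refine le_trans ?_ (lintegral_pullsIn_compl_mono π hxy hT hown hn)
  refine le_trans ?_ (lintegral_pullsIn_compl_succ_ge π hxy hT hown 0)
  refine le_trans ?_ le_add_self
  have e : ∀ w : Fin 0 → Round K,
      ENNReal.ofReal (1 - (trust {y} (fun i => (w i).pm) 0 : ℝ)) * 2⁻¹
        = ENNReal.ofReal (1 / 4) := by
    intro w
    rw [coe_trust _ _ le_rfl, alpha_zero, show (2⁻¹ : ENNReal) = ENNReal.ofReal 2⁻¹ by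
      rw [ENNReal.ofReal_inv_of_pos two_pos]; simp, ← ENNReal.ofReal_mul (by norm_num)]
    norm_num
  simp [e]

/-- Once `y` is unlikely to have been recommended late, each round is a deviation from `y` with
probability at least `1 / 8`. -/
lemma lintegral_pullsIn_compl_succ_ge_of_lateRec (hxy : x ≠ y) (hT : M.trustSet = {y})
    (hown : ∀ n, (M.ownPolicy n : Measure (Fin K)) = uniformOn {x, y}) {m n : ℕ}
    (hmn : 2 * m ≤ n) (hlate : M.law π n (lateRec y m) ≤ 2⁻¹) :
    ∫⁻ w, (pullsIn {y}ᶜ w : ENNReal) ∂M.law π n + ENNReal.ofReal (1 / 8)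
      ≤ ∫⁻ w, (pullsIn {y}ᶜ w : ENNReal) ∂M.law π (n + 1) := by
  refine le_trans ?_ (lintegral_pullsIn_compl_succ_ge π hxy hT hown n)
  gcongr
  have hm : MeasurableSet (lateRec y m : Set (Fin n → Round K))ᶜ :=
    (measurableSet_lateRec y m).compl
  have h2 : (2⁻¹ : ENNReal) = ENNReal.ofReal (1 / 2) := by
    rw [one_div, ENNReal.ofReal_inv_of_pos two_pos]; simp
  have h1 : (2⁻¹ : ENNReal) ≤ M.law π n (lateRec y m)ᶜ := by
    rw [prob_compl_eq_one_sub (measurableSet_lateRec y m)]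
    refine le_trans ?_ (tsub_le_tsub_left hlate 1)
    rw [ENNReal.one_sub_inv_two]
  calc ENNReal.ofReal (1 / 8) = ENNReal.ofReal (1 / 4) * 2⁻¹ := by
        rw [h2, ← ENNReal.ofReal_mul (by norm_num)]; norm_num
    _ ≤ ENNReal.ofReal (1 / 4) * M.law π n (lateRec y m)ᶜ := by gcongr
    _ = ∫⁻ w, (lateRec y m)ᶜ.indicator (fun _ => ENNReal.ofReal (1 / 4)) w ∂M.law π n := by
        rw [lintegral_indicator_const hm]
    _ ≤ _ := by
        refine lintegral_mono fun w => Set.indicator_le' (s := (lateRec y m)ᶜ)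
          (f := fun _ => ENNReal.ofReal (1 / 4))
          (g := fun w : Fin n → Round K =>
            ENNReal.ofReal (1 - (trust {y} (fun i => (w i).pm) n : ℝ)) * 2⁻¹) ?_ ?_ w
        · intro w hw
          have hα := alpha_le_of_forall_notMem {y} (fun i => (w i).pm) (m := m)
            (fun i hi h => hw ⟨i, hi, by simpa using h⟩) n
          have hα' : (alpha {y} (fun i => (w i).pm) n : ℝ) ≤ m + 1 := by exact_mod_cast hα
          have hmn' : (2 * m : ℝ) ≤ n := by exact_mod_cast hmn
          have ht : (trust {y} (fun i => (w i).pm) n : ℝ) ≤ 1 / 2 := by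
            rw [coe_trust _ _ le_rfl, div_le_iff₀ (by positivity)]
            linarith
          rw [h2, ← ENNReal.ofReal_mul (by linarith)]
          exact ENNReal.ofReal_le_ofReal (by linarith)
        · exact fun _ _ => zero_le

/-- If all arms but `y` fall short of the optimum by `Δ`, the regret is `Δ` times the expected
number of deviations from `y`. -/
lemma expectedRegret_eq {Δ : ℝ} (hΔ : ∀ k, M.optMean - M.mean k = if k = y then 0 else Δ) (H : ℕ) :
    M.expectedRegret π H
      = Δ * (∫⁻ w, (pullsIn {y}ᶜ w : ENNReal) ∂M.law π H).toReal := by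
  have e : ∀ w : Fin H → Round K,
      ∑ i, (M.optMean - M.mean (w i).ac) = Δ * (pullsIn {y}ᶜ w : ℝ) := by
    intro w
    simp only [hΔ, pullsIn, Finset.mem_compl, Finset.mem_singleton]
    rw [Finset.sum_ite, Finset.sum_const_zero, zero_add, Finset.sum_const, nsmul_eq_mul, mul_comm]
  have hm : Measurable fun w : Fin H → Round K => (pullsIn {y}ᶜ w : ℝ) := by fun_prop
  simp only [expectedRegret, e]
  rw [integral_const_mul, integral_eq_lintegral_of_nonneg_ae
    (Filter.Eventually.of_forall fun w => Nat.cast_nonneg _) hm.aestronglyMeasurable]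
  simp

end TrustBandit

/-- If UCB is unlikely to recommend `y` after the first `m` rounds, it deviates from `y` linearly
often. -/
lemma TrustBandit.le_lintegral_pullsIn_compl_of_lateRec {K : ℕ} {M : TrustBandit K} (π : Policy K)
    {x y : Fin K} (hxy : x ≠ y) (hT : M.trustSet = {y})
    (hown : ∀ n, (M.ownPolicy n : Measure (Fin K)) = uniformOn {x, y}) {m N : ℕ}
    (hlate : ∀ n ≤ N, M.law π n (lateRec y m) ≤ 2⁻¹) {k : ℕ} (hk : 2 * m + k ≤ N) :
    ENNReal.ofReal (k / 8) ≤ ∫⁻ w, (pullsIn {y}ᶜ w : ENNReal) ∂M.law π (2 * m + k) := by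
  induction k with
  | zero => simp
  | succ k ih =>
    have h := lintegral_pullsIn_compl_succ_ge_of_lateRec π hxy hT hown (m := m)
      (n := 2 * m + k) (by omega) (hlate _ (by omega))
    refine le_trans ?_ h
    rw [Nat.cast_succ, add_div, ENNReal.ofReal_add (by positivity) (by norm_num)]
    gcongr
    exact ih (by omega)

lemma linear_le_exp {L : ℝ} (hL : 20 ≤ L) : 120 * L + 4 ≤ Real.exp L := by
  have h := Real.pow_div_factorial_le_exp L (by linarith) 4
  norm_num [Nat.factorial] at h
  have h1 : (20 : ℝ) ^ 3 ≤ L ^ 3 := pow_le_pow_left₀ (by norm_num) hL 3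
  have h2 : L * 20 ^ 3 ≤ L * L ^ 3 := by gcongr
  nlinarith

/-! ### The hard instance -/

/-- The mean rewards of the hard instance, where `L` is the logarithm of the horizon. -/
def hardMean (L : ℝ) (k : Fin 260) : ℝ :=
  if k = Fin.last 259 then 1 / (3 * √(L + 1)) else 1 / (6 * √(L + 1))

lemma hardMean_mem_Icc {L : ℝ} (hL : 0 ≤ L) (k : Fin 260) : hardMean L k ∈ Set.Icc (0 : ℝ) 1 := by
  have h : 1 ≤ √(L + 1) := Real.one_le_sqrt.2 (by linarith)
  unfold hardMean
  split_ifs <;>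
  exact ⟨by positivity, (div_le_one (by positivity)).2 (by linarith)⟩

lemma hardMean_le_last (L : ℝ) (k : Fin 260) : hardMean L k ≤ hardMean L (Fin.last 259) := by
  unfold hardMean
  rw [if_pos rfl]
  split_ifs
  · exact le_rfl
  · rcases (Real.sqrt_nonneg (L + 1)).eq_or_lt with h | h
    · simp [← h]
    · exact one_div_le_one_div_of_le (by positivity) (by linarith)

/-- The hard instance: the rewards are deterministic, equal to `hardMean`; only the last arm is
trusted, and the own policy is uniform on the last two arms. -/
def hardBandit (L : ℝ) (hL : 0 ≤ L) : TrustBandit 260 where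
  rewardLaw := ⟨Measure.dirac (hardMean L), inferInstance⟩
  reward_mem := by
    rw [ProbabilityMeasure.coe_mk, ae_dirac_eq]
    exact hardMean_mem_Icc hL
  trustSet := {Fin.last 259}
  ownPolicy _ := ⟨uniformOn {258, Fin.last 259},
    isProbabilityMeasure_uniformOn (Set.toFinite _) (Set.insert_nonempty _ _)⟩
  exists_optimal_mem := ⟨Fin.last 259, Finset.mem_singleton_self _, fun j => by
    simpa [ProbabilityMeasure.coe_mk] using hardMean_le_last L j⟩

lemma mean_hardBandit (L : ℝ) (hL : 0 ≤ L) (k : Fin 260) :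
    (hardBandit L hL).mean k = hardMean L k := by
  simp [TrustBandit.mean, hardBandit]

lemma optMean_sub_mean_hardBandit (L : ℝ) (hL : 0 ≤ L) (k : Fin 260) :
    (hardBandit L hL).optMean - (hardBandit L hL).mean k
      = if k = Fin.last 259 then 0 else 1 / (6 * √(L + 1)) := by
  have h : (hardBandit L hL).optMean = hardMean L (Fin.last 259) := by
    rw [TrustBandit.optMean]
    simp only [mean_hardBandit]
    exact le_antisymm (ciSup_le (hardMean_le_last L))
      (le_ciSup (f := hardMean L) (Set.finite_range _).bddAbove _)
  rw [h, mean_hardBandit, hardMean, hardMean, if_pos rfl]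
  split_ifs
  · exact sub_self _
  · have : √(L + 1) ≠ 0 := (Real.sqrt_pos.2 (by linarith)).ne'
    field_simp
    norm_num

lemma law_hardBandit_lateRec_le {H : ℕ} (hH : 20 ≤ Real.log H) (hL : 0 ≤ Real.log H) {n : ℕ}
    (hn : n ≤ H) :
    (hardBandit (Real.log H) hL).law (ucbPolicy 260 H) n
        (TrustBandit.lateRec (Fin.last 259) ⌈30 * Real.log H⌉₊)
      ≤ ENNReal.ofReal (2 * Real.exp (14 - 2 * Real.log H)) := by
  refine TrustBandit.law_ucbPolicy_lateRec_le (x := 258) (by decide) rfl (fun _ => rfl) hH ?_ hn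
  change ∀ᵐ r ∂Measure.dirac (hardMean (Real.log H)), _
  rw [ae_dirac_eq]
  exact ⟨fun a => (hardMean_mem_Icc hL a).1, by simp [hardMean]⟩

/-- For horizons below `exp 20` the first round alone gives enough regret, as the constant is small;
for the others the deviations in the late rounds do. -/
lemma regret_hardBandit_ge {H : ℕ} (hH : 2 ≤ H) (hL : 0 ≤ Real.log H) :
    Real.exp (-20) / 200 * H / √(Real.log H)
      ≤ (hardBandit (Real.log H) hL).expectedRegret (ucbPolicy 260 H) H := by
  have hlog : 0.69 < Real.log H := by
    have h1 := Real.log_two_gt_d9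
    have h2 : Real.log 2 ≤ Real.log H := Real.log_le_log (by norm_num) (by exact_mod_cast hH)
    linarith
  have hH0 : (0 : ℝ) < H := by positivity
  have hexp : Real.exp (Real.log H) = H := Real.exp_log hH0
  rw [TrustBandit.expectedRegret_eq (y := Fin.last 259) (ucbPolicy 260 H)
    (optMean_sub_mean_hardBandit _ hL)]
  set D := ∫⁻ w, (pullsIn {Fin.last 259}ᶜ w : ENNReal)
    ∂(hardBandit (Real.log H) hL).law (ucbPolicy 260 H) H with hD
  have hDtop : D ≠ ⊤ := ne_top_of_le_ne_top (ENNReal.natCast_ne_top H)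
    (TrustBandit.lintegral_pullsIn_compl_le _ _ _)
  have hΔ : 1 / (12 * √(Real.log H)) ≤ 1 / (6 * √(Real.log H + 1)) := by
    refine one_div_le_one_div_of_le (by positivity) ?_
    have h1 : √(Real.log H + 1) ≤ √(2 ^ 2 * Real.log H) := Real.sqrt_le_sqrt (by linarith)
    rw [Real.sqrt_mul (by norm_num), Real.sqrt_sq zero_le_two] at h1
    linarith
  have hs : 0 < √(Real.log H) := Real.sqrt_pos.2 (by linarith)
  -- It suffices to bound the expected number of deviations.
  suffices h : Real.exp (-20) * H / 16 ≤ D.toReal by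
    calc Real.exp (-20) / 200 * H / √(Real.log H)
        ≤ 1 / (12 * √(Real.log H)) * (Real.exp (-20) * H / 16) := by
          rw [div_mul_div_comm, div_le_div_iff₀ (by positivity) (by positivity)]
          have : 0 < Real.exp (-20) * H * √(Real.log H) := by positivity
          nlinarith
      _ ≤ 1 / (6 * √(Real.log H + 1)) * D.toReal := by gcongr
  have hxy : (258 : Fin 260) ≠ Fin.last 259 := by decide
  rcases lt_or_ge (Real.log H) 20 with h20 | h20
  · have h1 := TrustBandit.one_div_four_le_lintegral_pullsIn_compl
      (M := hardBandit (Real.log H) hL) (ucbPolicy 260 H) hxy rfl (fun _ => rfl)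
      (show 1 ≤ H by omega)
    have h2 := (ENNReal.ofReal_le_iff_le_toReal hDtop).1 h1
    have h3 : Real.exp (-20) * H ≤ 1 := by
      rw [← hexp, ← Real.exp_add, Real.exp_le_one_iff]
      linarith
    linarith
  · have hlate : ∀ n ≤ H, (hardBandit (Real.log H) hL).law (ucbPolicy 260 H) n
        (TrustBandit.lateRec (Fin.last 259) ⌈30 * Real.log H⌉₊) ≤ 2⁻¹ := by
      intro n hn
      refine (law_hardBandit_lateRec_le h20 hL hn).trans ?_
      rw [show (2⁻¹ : ENNReal) = ENNReal.ofReal 2⁻¹ by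
        rw [ENNReal.ofReal_inv_of_pos two_pos]; simp]
      refine ENNReal.ofReal_le_ofReal ?_
      have h1 : Real.exp (14 - 2 * Real.log H) ≤ Real.exp (-3) := by gcongr; linarith
      have h2 : Real.exp (-3) * Real.exp 3 = 1 := by rw [← Real.exp_add]; simp
      have h3 := Real.add_one_le_exp (3 : ℝ)
      nlinarith [Real.exp_pos (-3 : ℝ)]
    have hceil : (⌈30 * Real.log H⌉₊ : ℝ) < 30 * Real.log H + 1 :=
      Nat.ceil_lt_add_one (by linarith)
    have hlin := linear_le_exp h20
    rw [hexp] at hlin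
    have hle : 2 * ⌈30 * Real.log H⌉₊ ≤ H := by
      have : (2 * ⌈30 * Real.log H⌉₊ : ℝ) ≤ H := by linarith
      exact_mod_cast this
    obtain ⟨k, hk⟩ := Nat.exists_eq_add_of_le hle
    have h1 := TrustBandit.le_lintegral_pullsIn_compl_of_lateRec
      (M := hardBandit (Real.log H) hL) (ucbPolicy 260 H) hxy rfl (fun _ => rfl) hlate hk.ge
    rw [← hk, ← hD] at h1
    have h2 := (ENNReal.ofReal_le_iff_le_toReal hDtop).1 h1
    have h3 : (H : ℝ) = 2 * ⌈30 * Real.log H⌉₊ + k := by exact_mod_cast hk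
    have h4 : Real.exp (-20) * H ≤ H :=
      mul_le_of_le_one_left hH0.le (Real.exp_le_one_iff.2 (by norm_num))
    linarith

/-- For horizons below `exp 20` the event is empty, as the constant is large; for the others it is
contained in the event that the last arm is recommended late. -/
lemma law_trustSum_hardBandit_le {H : ℕ} (hH : 2 ≤ H) (hL : 0 ≤ Real.log H) :
    ((hardBandit (Real.log H) hL).law (ucbPolicy 260 H) H).real
        {w | 3 * Real.exp 20 * Real.log H ^ 2 < (hardBandit (Real.log H) hL).trustSum w}
      ≤ 4 * (H : ℝ) ^ (-(1 / 3) : ℝ) := by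
  have hlog : 0.69 < Real.log H := by
    have h1 := Real.log_two_gt_d9
    have h2 : Real.log 2 ≤ Real.log H := Real.log_le_log (by norm_num) (by exact_mod_cast hH)
    linarith
  have hH0 : (0 : ℝ) < H := by positivity
  have hexp : Real.exp (Real.log H) = H := Real.exp_log hH0
  rcases lt_or_ge (Real.log H) 20 with h20 | h20
  · have hempty : {w : Fin H → Round 260 | 3 * Real.exp 20 * Real.log H ^ 2
        < (hardBandit (Real.log H) hL).trustSum w} = ∅ := by
      refine Set.eq_empty_of_forall_notMem fun w hw => not_le.2 (Set.mem_ofPred_eq ▸ hw) ?_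
      have h1 : (hardBandit (Real.log H) hL).trustSum w ≤ H := by
        refine (Finset.sum_le_sum fun j _ => (trust _ _ j).2.2).trans ?_
        simp
      have h2 : (H : ℝ) ≤ Real.exp 20 := by rw [← hexp]; gcongr
      have h3 : 1 ≤ 3 * Real.log H ^ 2 := by nlinarith
      nlinarith [Real.exp_pos (20 : ℝ)]
    rw [hempty, measureReal_empty]
    positivity
  · have hsub : {w : Fin H → Round 260 | 3 * Real.exp 20 * Real.log H ^ 2
        < (hardBandit (Real.log H) hL).trustSum w}
        ⊆ TrustBandit.lateRec (Fin.last 259) ⌈30 * Real.log H⌉₊ := by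
      intro w hw
      rw [Set.mem_ofPred_eq] at hw
      by_contra hlate
      refine not_le.2 hw ?_
      have hα := alpha_le_of_forall_notMem {Fin.last 259} (fun i => (w i).pm)
        (m := ⌈30 * Real.log H⌉₊) (fun i hi h => hlate ⟨i, hi, by simpa using h⟩) H
      have hceil : (⌈30 * Real.log H⌉₊ : ℝ) < 30 * Real.log H + 1 :=
        Nat.ceil_lt_add_one (by linarith)
      have hα' : (alpha {Fin.last 259} (fun i => (w i).pm) H : ℝ)
          ≤ (⌈30 * Real.log H⌉₊ : ℝ) + 1 := by exact_mod_cast hα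
      have h1 : (hardBandit (Real.log H) hL).trustSum w
          ≤ (30 * Real.log H + 2) * Real.log (H + 1) :=
        sum_trust_le {Fin.last 259} (fun i => (w i).pm) (by linarith)
      have h2 : Real.log (H + 1) ≤ 2 * Real.log H := by
        have h3 : (2 : ℝ) ≤ H := by exact_mod_cast hH
        have h4 := Real.log_le_log (by positivity) (show (H + 1 : ℝ) ≤ H ^ 2 by nlinarith)
        rwa [Real.log_pow, Nat.cast_two] at h4
      have h5 := mul_le_mul_of_nonneg_left h2 (show 0 ≤ 30 * Real.log H + 2 by linarith)
      have h6 : 21 ≤ Real.exp 20 := by linarith [Real.add_one_le_exp (20 : ℝ)]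
      have h7 := mul_le_mul_of_nonneg_right h6 (sq_nonneg (Real.log H))
      nlinarith
    refine (measureReal_mono hsub).trans ?_
    refine (ENNReal.toReal_le_of_le_ofReal (by positivity)
      (law_hardBandit_lateRec_le h20 hL le_rfl)).trans ?_
    rw [Real.rpow_def_of_pos hH0]
    have h1 : Real.exp (14 - 2 * Real.log H) ≤ Real.exp (Real.log H * -(1 / 3)) := by
      gcongr
      linarith
    linarith [Real.exp_pos (Real.log H * -(1 / 3))]

end TrustMAB

end

theorem theorem1 :
    ∃ c C : ℝ, 0 < c ∧ 0 < C ∧ ∀ H : ℕ, 2 ≤ H →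
      ∃ M : TrustMAB.TrustBandit 260,
        M.trustSet = {Fin.last 259} ∧
        (∀ n, (M.ownPolicy n : MeasureTheory.Measure (Fin 260))
          = ProbabilityTheory.uniformOn {(258 : Fin 260), Fin.last 259}) ∧
        (∀ k, M.mean k =
          if k = Fin.last 259 then 1 / (3 * √(Real.log H + 1))
          else 1 / (6 * √(Real.log H + 1))) ∧
        c * H / √(Real.log H) ≤ M.expectedRegret (TrustMAB.ucbPolicy 260 H) H ∧
        (M.law (TrustMAB.ucbPolicy 260 H) H).real {w | C * Real.log H ^ 2 < M.trustSum w}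
          ≤ 4 * (H : ℝ) ^ (-(1 / 3) : ℝ) := by
  refine ⟨Real.exp (-20) / 200, 3 * Real.exp 20, by positivity, by positivity, fun H hH => ?_⟩
  have hL : 0 ≤ Real.log H := Real.log_natCast_nonneg H
  exact ⟨TrustMAB.hardBandit (Real.log H) hL, rfl, fun _ => rfl,
    TrustMAB.mean_hardBandit _ hL, TrustMAB.regret_hardBandit_ge hH hL,
    TrustMAB.law_trustSum_hardBandit_le hH hL⟩
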